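/- All graphs are finite, simple and undirected, and $d(v)$ denotes the degree of a vertex $v$. The $m$-degree $m(G)$ of a graph $G$ is the largest integer $k$ such that $G$ has at least $k$ vertices of degree at least $k-1$. A vertex of $G$ is dense if $d(v)\ge m(G)-1$, and $G$ is tight if it has exactly $m(G)$ dense vertices, each of degree exactly $m(G)-1$. A colouring of $G$ assigns colours to the vertices such that adjacent vertices receive different colours. It is a b-colouring if every colour class contains a vertex that has a neighbour in every other colour class. A tight b-colouring of $G$ is a b-colouring that uses exactly $m(G)$ colours. Tight b-Chromatic Number is the problem of deciding whether a given tight graph has a tight b-colouring. A graph is $(P_3+P_1)$-free if it has no induced subgraph isomorphic to $P_3+P_1$, the disjoint union of a path on three vertices and a single vertex. **Lemma.** Tight b-Chromatic Number is polynomial-time solvable for $(P_3+P_1)$-free graphs. That is, there are an algorithm and a polynomial $b$ such that, for every $n$, given the adjacency matrix of a tight $(P_3+P_1)$-free graph $G$ on $n$ vertices, the algorithm halts after at most $b(n)$ steps and correctly decides whether $G$ has a tight b-colouring. Here an algorithm is a program for a random access machine over the natural numbers, where each addition, truncated subtraction, test and memory access counts as one step. -/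

import Mathlib

/-! ### Random access machines

Programs over natural-number variables and finitely many one-dimensional arrays with indirect
addressing.  The arithmetic is addition and truncated subtraction only (no multiplication), so that
in `t` steps numbers grow by at most `O(t)` bits and polynomial time under the unit cost below is
the same as polynomial time on a Turing machine. -/

namespace RAM

/-- Expressions: constants, variables `x₀, x₁, …`, addition, truncated subtraction and the entry of
array number `a` at a computed index. -/
inductive Expr : Type
  | const (k : ℕ)
  | var (x : ℕ)
  | add (e f : Expr)
  | sub (e f : Expr)
  | get (a : ℕ) (e : Expr)

/-- Programs. A condition holds if its value is non-zero. -/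
inductive Prog : Type
  | skip
  | assign (x : ℕ) (e : Expr)
  | put (a : ℕ) (i e : Expr)
  | seq (p q : Prog)
  | cond (e : Expr) (p q : Prog)
  | loop (e : Expr) (p : Prog)

/-- The memory: the values of the variables and of the array entries. -/
@[ext]
structure State : Type where
  var : ℕ → ℕ
  arr : ℕ → ℕ → ℕ

/-- The value of an expression. -/
def Expr.eval (s : State) : Expr → ℕ
  | .const k => k
  | .var x => s.var x
  | .add e f => e.eval s + f.eval s
  | .sub e f => e.eval s - f.eval s
  | .get a e => s.arr a (e.eval s)

/-- Evaluating an expression takes one step for each constant, variable, arithmetic operation and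
array access in it. -/
def Expr.cost : Expr → ℕ
  | .const _ => 1
  | .var _ => 1
  | .add e f => e.cost + f.cost + 1
  | .sub e f => e.cost + f.cost + 1
  | .get _ e => e.cost + 1

/-- The state after `x := v`. -/
def State.setVar (s : State) (x v : ℕ) : State :=
  { s with var := Function.update s.var x v }

/-- The state after `a[i] := v`. -/
def State.setArr (s : State) (a i v : ℕ) : State :=
  { s with arr := Function.update s.arr a (Function.update (s.arr a) i v) }

/-- `Exec p s t s'`: started in the state `s`, the program `p` halts after exactly `t` steps in the
state `s'`. Every assignment and every test counts one step plus the cost of its expressions. -/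
inductive Exec : Prog → State → ℕ → State → Prop
  | skip (s : State) : Exec .skip s 1 s
  | assign (x : ℕ) (e : Expr) (s : State) :
      Exec (.assign x e) s (e.cost + 1) (s.setVar x (e.eval s))
  | put (a : ℕ) (i e : Expr) (s : State) :
      Exec (.put a i e) s (i.cost + e.cost + 1) (s.setArr a (i.eval s) (e.eval s))
  | seq {p q : Prog} {s s₁ s₂ : State} {t₁ t₂ : ℕ} :
      Exec p s t₁ s₁ → Exec q s₁ t₂ s₂ → Exec (.seq p q) s (t₁ + t₂) s₂
  | cond_true {e : Expr} {p q : Prog} {s s₁ : State} {t : ℕ} :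
      e.eval s ≠ 0 → Exec p s t s₁ → Exec (.cond e p q) s (e.cost + 1 + t) s₁
  | cond_false {e : Expr} {p q : Prog} {s s₁ : State} {t : ℕ} :
      e.eval s = 0 → Exec q s t s₁ → Exec (.cond e p q) s (e.cost + 1 + t) s₁
  | loop_false {e : Expr} {p : Prog} {s : State} :
      e.eval s = 0 → Exec (.loop e p) s (e.cost + 1) s
  | loop_true {e : Expr} {p : Prog} {s s₁ s₂ : State} {t₁ t₂ : ℕ} :
      e.eval s ≠ 0 → Exec p s t₁ s₁ → Exec (.loop e p) s₁ t₂ s₂ →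
        Exec (.loop e p) s (e.cost + 1 + t₁ + t₂) s₂

open Classical in
/-- The initial memory for a graph with vertices `0, …, n - 1`: variable `0` holds `n`, array `0`
holds the adjacency matrix row by row, everything else is `0`. -/
noncomputable def graphInput {n : ℕ} (G : SimpleGraph (Fin n)) : State where
  var x := if x = 0 then n else 0
  arr a k := if a = 0 ∧ ∃ i j : Fin n, G.Adj i j ∧ k = (i : ℕ) * n + (j : ℕ) then 1 else 0

/-- The decision problem "given a finite graph satisfying `inst`, does it satisfy `yes`?" is
polynomial-time solvable: a single program halts on every graph satisfying `inst`, within a number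
of steps polynomial in the number of vertices, with a non-zero value in variable `0` exactly for
the yes-instances. -/
def PolyTimeSolvable (inst yes : ∀ {n : ℕ}, SimpleGraph (Fin n) → Prop) : Prop :=
  ∃ (p : Prog) (b : Polynomial ℕ), ∀ (n : ℕ) (G : SimpleGraph (Fin n)), inst G →
    ∃ (t : ℕ) (s : State), Exec p (graphInput G) t s ∧ t ≤ b.eval n ∧ (s.var 0 ≠ 0 ↔ yes G)

end RAM

/-! ### Tight graphs and b-colourings -/

namespace SimpleGraph

section

variable {V : Type*}

/-- `G` is `H`-free: `H` is not an induced subgraph of `G`. -/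
def IsInducedFree {W : Type*} (G : SimpleGraph V) (H : SimpleGraph W) : Prop :=
  ¬ H.IsIndContained G

open Classical in
/-- The `m`-degree: the largest `k` such that at least `k` vertices have degree at least `k - 1`. -/
noncomputable def mDegree [Fintype V] (G : SimpleGraph V) : ℕ :=
  Nat.findGreatest (fun k => k ≤ (Finset.univ.filter fun v => k ≤ G.degree v + 1).card)
    (Fintype.card V)

open Classical in
theorem isGreatest_mDegree [Fintype V] (G : SimpleGraph V) :
    IsGreatest {k : ℕ | k ≤ (Finset.univ.filter fun v => k ≤ G.degree v + 1).card} G.mDegree := by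
  constructor
  · exact Nat.findGreatest_spec
      (P := fun k => k ≤ (Finset.univ.filter fun v => k ≤ G.degree v + 1).card)
      (Nat.zero_le _) (Nat.zero_le _)
  · intro k hk
    exact Nat.le_findGreatest (le_trans hk (Finset.card_le_univ _)) hk

open Classical in
/-- A vertex is dense if its degree is at least `m(G) - 1`. -/
def IsDense [Fintype V] (G : SimpleGraph V) (v : V) : Prop :=
  G.mDegree ≤ G.degree v + 1

open Classical in
/-- `G` is tight if it has exactly `m(G)` dense vertices, each of degree exactly `m(G) - 1`. -/
def IsTight [Fintype V] (G : SimpleGraph V) : Prop :=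
  (Finset.univ.filter fun v => G.IsDense v).card = G.mDegree ∧
    ∀ v, G.IsDense v → G.degree v + 1 = G.mDegree

/-- A vertex is b-chromatic if it has a neighbour in every colour class other than its own. -/
def IsBChromatic {G : SimpleGraph V} {α : Type*} (c : G.Coloring α) (v : V) : Prop :=
  ∀ w, c w ≠ c v → ∃ u, G.Adj v u ∧ c u = c w

/-- A b-colouring is a (proper) colouring in which every colour class has a b-chromatic vertex. -/
def IsBColouring {G : SimpleGraph V} {α : Type*} (c : G.Coloring α) : Prop :=
  ∀ w, ∃ v, c v = c w ∧ IsBChromatic c v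

/-- `G` has a tight b-colouring: a b-colouring that uses exactly `m(G)` colours. -/
def HasTightBColouring [Fintype V] (G : SimpleGraph V) : Prop :=
  ∃ c : G.Coloring (Fin G.mDegree), Function.Surjective c ∧ IsBColouring c

end

end SimpleGraph

/-!
Let `G` be tight with `m = m(G)`. The dense vertices and the closed neighbourhoods of dense vertices
are sets with exactly `m` elements, so a proper `m`-colouring is a b-colouring if and only if it is
injective on each of them.

The complement of `P₃ + P₁` is the paw. By Olariu's theorem, a connected paw-free graph is
triangle-free or complete multipartite. There are thus three cases for a `(P₃ + P₁)`-free `G`.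

* If `Gᶜ` is complete multipartite, then `G` is a disjoint union of complete graphs with at most `m`
  vertices each, and it always has a tight b-colouring.
* If `Gᶜ` is disconnected and `G` has a tight b-colouring, then two vertices of the same colour
  would both be adjacent to a dense vertex from another component of `Gᶜ`. So all colours are
  distinct, `G` is complete, and this falls under the first case.
* If `Gᶜ` is triangle-free, colour classes have at most two vertices. Since every colour occurs on
  exactly one dense vertex, a tight b-colouring amounts to an injective choice of a dense partner
  for each non-dense vertex `v`; a dense vertex `d` qualifies if the dense vertices not adjacent to
  `d` are exactly the dense neighbours of `v`. Whether `d` qualifies depends only on a set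
  attached to `v` and a set attached to `d`, so Hall's condition reduces to comparing, for each
  set, the number of non-dense `v` and of dense `d` to which it is attached.

These criteria are formulas in adjacency and equality of vertices, built with quantifiers and
comparisons of cardinalities of definable sets, and such formulas are evaluated by nested loops
over the vertices.
-/

/-! ### Programs with time bounds -/

namespace RAM

/-- The total-correctness triple with a time bound: started in `s`, the program `p` halts within
`T` steps in a state satisfying `Q`. -/
def HaltsWithin (p : Prog) (s : State) (T : ℕ) (Q : State → Prop) : Prop :=
  ∃ t s', Exec p s t s' ∧ t ≤ T ∧ Q s'

theorem haltsWithin_assign {x : ℕ} {e : Expr} {s : State} {Q : State → Prop}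
    (h : Q (s.setVar x (e.eval s))) : HaltsWithin (.assign x e) s (e.cost + 1) Q :=
  ⟨_, _, .assign x e s, le_rfl, h⟩

namespace HaltsWithin

variable {p q : Prog} {s : State} {T T₁ T₂ : ℕ} {Q R : State → Prop}

theorem mono (h : HaltsWithin p s T₁ Q) (hT : T₁ ≤ T₂) (hQ : ∀ s', Q s' → R s') :
    HaltsWithin p s T₂ R :=
  let ⟨t, s', hp, ht, hs'⟩ := h
  ⟨t, s', hp, ht.trans hT, hQ s' hs'⟩

theorem seq (hp : HaltsWithin p s T₁ Q) (hq : ∀ s₁, Q s₁ → HaltsWithin q s₁ T₂ R) :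
    HaltsWithin (.seq p q) s (T₁ + T₂) R := by
  obtain ⟨t₁, s₁, hp, ht₁, hs₁⟩ := hp
  obtain ⟨t₂, s₂, hq, ht₂, hs₂⟩ := hq s₁ hs₁
  exact ⟨_, s₂, hp.seq hq, add_le_add ht₁ ht₂, hs₂⟩

theorem loop {e : Expr} {N : ℕ} {Inv : ℕ → State → Prop}
    (hstep : ∀ i < N, ∀ s, Inv i s → e.eval s ≠ 0 ∧ HaltsWithin p s T (Inv (i + 1)))
    (hexit : ∀ s, Inv N s → e.eval s = 0) (hs : Inv 0 s) :
    HaltsWithin (.loop e p) s (N * (e.cost + 1 + T) + (e.cost + 1)) (Inv N) := by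
  suffices ∀ r i, i + r = N → ∀ s, Inv i s →
      HaltsWithin (.loop e p) s (r * (e.cost + 1 + T) + (e.cost + 1)) (Inv N) from
    this N 0 (zero_add N) s hs
  intro r
  induction r with
  | zero =>
    rintro i rfl s hs
    exact ⟨_, s, .loop_false (hexit s hs), by simp, hs⟩
  | succ r ih =>
    intro i hi s hs
    obtain ⟨hne, t₁, s₁, hp, ht₁, hs₁⟩ := hstep i (by omega) s hs
    obtain ⟨t₂, s₂, hloop, ht₂, hs₂⟩ := ih (i + 1) (by omega) s₁ hs₁
    refine ⟨_, s₂, .loop_true hne hp hloop, ?_, hs₂⟩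
    rw [add_one_mul]
    omega

end HaltsWithin

/-- The states `s` and `s'` have the same arrays and the same variables with numbers below `r`. -/
def AgreeBelow (r : ℕ) (s s' : State) : Prop :=
  s'.arr = s.arr ∧ ∀ x < r, s'.var x = s.var x

namespace AgreeBelow

variable {r r' x w : ℕ} {s s₁ s₂ : State}

theorem refl (r : ℕ) (s : State) : AgreeBelow r s s :=
  ⟨rfl, fun _ _ => rfl⟩

theorem trans (h₁ : AgreeBelow r s s₁) (h₂ : AgreeBelow r' s₁ s₂) (hr : r ≤ r') :
    AgreeBelow r s s₂ :=
  ⟨h₂.1.trans h₁.1, fun x hx => (h₂.2 x (hx.trans_le hr)).trans (h₁.2 x hx)⟩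

theorem setVar (h : AgreeBelow r s s₁) (hx : r ≤ x) : AgreeBelow r s (s₁.setVar x w) :=
  ⟨h.1, fun y hy => (Function.update_of_ne (hy.trans_le hx).ne _ _).trans (h.2 y hy)⟩

end AgreeBelow

theorem State.setVar_var_self (s : State) (x w : ℕ) : (s.setVar x w).var x = w :=
  Function.update_self ..

theorem State.setVar_var_of_ne (s : State) {x y : ℕ} (h : y ≠ x) (w : ℕ) :
    (s.setVar x w).var y = s.var y :=
  Function.update_of_ne h ..

/-! ### Polynomial-time computable functions of vertices -/

/-- The input graph `G` is in place in the memory, and the variable `loc i` holds the vertex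
`v i`. -/
def Stores {ι : Type*} {n : ℕ} (s : State) (G : SimpleGraph (Fin n)) (loc : ι → ℕ)
    (v : ι → Fin n) : Prop :=
  s.var 0 = n ∧ s.arr = (graphInput G).arr ∧ ∀ i, s.var (loc i) = v i

theorem Stores.of_agreeBelow {ι : Type*} {n r : ℕ} {s s' : State} {G : SimpleGraph (Fin n)}
    {loc : ι → ℕ} {v : ι → Fin n} (hs : Stores s G loc v) (h : AgreeBelow r s s') (hr : 0 < r)
    (hloc : ∀ i, loc i < r) : Stores s' G loc v :=
  ⟨(h.2 0 hr).trans hs.1, h.1.trans hs.2.1, fun i => (h.2 _ (hloc i)).trans (hs.2.2 i)⟩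

/-- A number depending on a graph and on vertices `v i` of it can be computed in polynomial time.
The programs must work for all locations of the vertices, put the result into any prescribed
variable `r` and preserve the variables below `r`: so they can be composed, with the variables from
`r` on as a stack. -/
def PolyTimeComputable {ι : Type*} (F : ∀ n, SimpleGraph (Fin n) → (ι → Fin n) → ℕ) : Prop :=
  ∀ (loc : ι → ℕ) (r : ℕ), 0 < r → (∀ i, loc i < r) → ∃ (p : Prog) (b : Polynomial ℕ),
    ∀ (n : ℕ) (G : SimpleGraph (Fin n)) (v : ι → Fin n) (s : State), Stores s G loc v →
      HaltsWithin p s (b.eval n) fun s' => AgreeBelow r s s' ∧ s'.var r = F n G v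

open Classical in
/-- A relation between vertices of a graph whose indicator function can be computed in polynomial
time. -/
def PolyTimeDecidable {ι : Type*} (P : ∀ n, SimpleGraph (Fin n) → (ι → Fin n) → Prop) : Prop :=
  PolyTimeComputable fun n G v => if P n G v then 1 else 0

namespace PolyTimeComputable

variable {ι : Type*} {F F' : ∀ n, SimpleGraph (Fin n) → (ι → Fin n) → ℕ}

theorem of_eq (h : PolyTimeComputable F) (heq : ∀ n G v, F n G v = F' n G v) :
    PolyTimeComputable F' := by
  obtain rfl : F = F' := funext fun n => funext fun G => funext fun v => heq n G v
  exact h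

theorem const (k : ℕ) :
    PolyTimeComputable fun n (_ : SimpleGraph (Fin n)) (_ : ι → Fin n) => k := by
  intro loc r _ _
  refine ⟨.assign r (.const k), 2, fun n G v s _ => ?_⟩
  refine (haltsWithin_assign ?_).mono (by simp [Expr.cost]) fun _ => id
  exact ⟨(AgreeBelow.refl r s).setVar le_rfl, s.setVar_var_self ..⟩

theorem vertex (i : ι) :
    PolyTimeComputable fun n (_ : SimpleGraph (Fin n)) (v : ι → Fin n) => v i := by
  intro loc r _ _
  refine ⟨.assign r (.var (loc i)), 2, fun n G v s hs => ?_⟩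
  refine (haltsWithin_assign ?_).mono (by simp [Expr.cost]) fun _ => id
  exact ⟨(AgreeBelow.refl r s).setVar le_rfl, (s.setVar_var_self ..).trans (hs.2.2 i)⟩

theorem map₂ {f : ℕ → ℕ → ℕ} (op : Expr → Expr → Expr)
    (hop : ∀ e e' s, (op e e').eval s = f (e.eval s) (e'.eval s))
    (hF : PolyTimeComputable F) (hF' : PolyTimeComputable F') :
    PolyTimeComputable fun n G v => f (F n G v) (F' n G v) := by
  intro loc r hr hloc
  obtain ⟨p, b, hp⟩ := hF loc r hr hloc
  obtain ⟨p', b', hp'⟩ := hF' loc (r + 1) r.succ_pos fun i => (hloc i).trans r.lt_succ_self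
  let e := op (.var r) (.var (r + 1))
  refine ⟨.seq p (.seq p' (.assign r e)), b + (b' + Polynomial.C (e.cost + 1)),
    fun n G v s hs => ?_⟩
  simp only [Polynomial.eval_add, Polynomial.eval_C]
  refine (hp n G v s hs).seq fun s₁ ⟨h₁, hr₁⟩ => ?_
  refine (hp' n G v s₁ (hs.of_agreeBelow h₁ hr hloc)).seq fun s₂ ⟨h₂, hr₂⟩ => ?_
  refine haltsWithin_assign ⟨(h₁.trans h₂ r.le_succ).setVar le_rfl, ?_⟩
  rw [State.setVar_var_self, hop]
  exact congrArg₂ f ((h₂.2 r r.lt_succ_self).trans hr₁) hr₂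

theorem add (hF : PolyTimeComputable F) (hF' : PolyTimeComputable F') :
    PolyTimeComputable fun n G v => F n G v + F' n G v :=
  map₂ .add (fun _ _ _ => rfl) hF hF'

theorem sub (hF : PolyTimeComputable F) (hF' : PolyTimeComputable F') :
    PolyTimeComputable fun n G v => F n G v - F' n G v :=
  map₂ .sub (fun _ _ _ => rfl) hF hF'

theorem adjMatrixEntry (hF : PolyTimeComputable F) :
    PolyTimeComputable fun n G v => (graphInput G).arr 0 (F n G v) := by
  intro loc r hr hloc
  obtain ⟨p, b, hp⟩ := hF loc r hr hloc
  refine ⟨.seq p (.assign r (.get 0 (.var r))), b + 3, fun n G v s hs => ?_⟩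
  simp only [Polynomial.eval_add, Polynomial.eval_ofNat]
  refine (hp n G v s hs).seq fun s₁ ⟨h₁, hr₁⟩ => ?_
  refine haltsWithin_assign ⟨h₁.setVar le_rfl, ?_⟩
  rw [State.setVar_var_self, Expr.eval, Expr.eval, hr₁, h₁.1, hs.2.1]

/-- A program for `∑ u, F (v, u)`: the sum is accumulated in the variable `r`, the variable `r + 1`
runs over `u`, and the program `p` leaves the summand in the variable `r + 2`. -/
def sumProg (r : ℕ) (p : Prog) : Prog :=
  .seq (.assign r (.const 0)) (.seq (.assign (r + 1) (.const 0))
    (.loop (.sub (.var 0) (.var (r + 1)))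
      (.seq p (.seq (.assign r (.add (.var r) (.var (r + 2))))
        (.assign (r + 1) (.add (.var (r + 1)) (.const 1)))))))

theorem haltsWithin_sumProg {r n T : ℕ} {p : Prog} {s : State} {g : ℕ → ℕ} (hr : 0 < r)
    (hn : s.var 0 = n)
    (hp : ∀ j < n, ∀ s₁, AgreeBelow r s s₁ → s₁.var (r + 1) = j →
      HaltsWithin p s₁ T fun s₂ => AgreeBelow (r + 2) s₁ s₂ ∧ s₂.var (r + 2) = g j) :
    HaltsWithin (sumProg r p) s (n * (T + 12) + 8) fun s' =>
      AgreeBelow r s s' ∧ s'.var r = ∑ j ∈ Finset.range n, g j := by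
  let Inv (j : ℕ) (s' : State) : Prop :=
    AgreeBelow r s s' ∧ s'.var (r + 1) = j ∧ s'.var r = ∑ i ∈ Finset.range j, g i
  have hguard {j : ℕ} {s' : State} (hs' : Inv j s') :
      (Expr.sub (.var 0) (.var (r + 1))).eval s' = n - j := by
    rw [Expr.eval, Expr.eval, Expr.eval, hs'.1.2 0 hr, hn, hs'.2.1]
  have hbody (j : ℕ) (hj : j < n) (s₁ : State) (hs₁ : Inv j s₁) :
      HaltsWithin (.seq p (.seq (.assign r (.add (.var r) (.var (r + 2))))
        (.assign (r + 1) (.add (.var (r + 1)) (.const 1))))) s₁ (T + (4 + 4)) (Inv (j + 1)) := by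
    obtain ⟨h₁, hcount, hsum⟩ := hs₁
    refine (hp j hj s₁ h₁ hcount).seq fun s₂ ⟨h₂, hg⟩ => ?_
    refine (haltsWithin_assign rfl).seq fun s₃ hs₃ => haltsWithin_assign ?_
    subst hs₃
    refine ⟨((h₁.trans h₂ (by omega)).setVar le_rfl).setVar r.le_succ, ?_, ?_⟩
    · simp only [Expr.eval, State.setVar_var_self]
      rw [State.setVar_var_of_ne _ (by omega), h₂.2 _ (by omega), hcount]
    · rw [State.setVar_var_of_ne _ (by omega), State.setVar_var_self]
      simp only [Expr.eval]
      rw [h₂.2 _ (by omega), hg, hsum, Finset.sum_range_succ]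
  have hloop (s' : State) (hs' : Inv 0 s') :=
    HaltsWithin.loop (fun j hj s₁ hs₁ => ⟨by rw [hguard hs₁]; omega, hbody j hj s₁ hs₁⟩)
      (fun s₁ hs₁ => by rw [hguard hs₁, Nat.sub_self]) hs'
  refine ((haltsWithin_assign rfl).seq fun s₁ hs₁ => (haltsWithin_assign rfl).seq fun s₂ hs₂ =>
    hloop s₂ ?_).mono (by simp only [Expr.cost]; ring_nf; omega) fun s' hs' => ⟨hs'.1, hs'.2.2⟩
  subst hs₁ hs₂
  refine ⟨((AgreeBelow.refl r s).setVar le_rfl).setVar r.le_succ, State.setVar_var_self .., ?_⟩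
  rw [State.setVar_var_of_ne _ (by omega), State.setVar_var_self, Expr.eval, Finset.sum_range_zero]

theorem sum {F : ∀ n, SimpleGraph (Fin n) → (ι → Fin n) → Fin n → ℕ}
    (hF : PolyTimeComputable fun n G (w : Option ι → Fin n) => F n G (w ∘ some) (w none)) :
    PolyTimeComputable fun n G v => ∑ u, F n G v u := by
  intro loc r hr hloc
  obtain ⟨p, b, hp⟩ := hF (fun i => i.elim (r + 1) loc) (r + 2) (by omega) (by
    rintro (_ | i)
    · exact Nat.lt_succ_self _
    · exact (hloc i).trans (by simp))
  refine ⟨sumProg r p, .X * (b + 12) + 8, fun n G v s hs => ?_⟩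
  simp only [Polynomial.eval_add, Polynomial.eval_mul, Polynomial.eval_X, Polynomial.eval_ofNat]
  let g (j : ℕ) : ℕ := if hj : j < n then F n G v ⟨j, hj⟩ else 0
  have hg (u : Fin n) : g u = F n G v u := dif_pos u.isLt
  refine (haltsWithin_sumProg (g := g) hr hs.1 fun j hj s₁ h₁ hcount => ?_).mono le_rfl
    fun s' hs' => ⟨hs'.1, by simpa only [Finset.sum_range, hg] using hs'.2⟩
  have hs₁ := hs.of_agreeBelow h₁ hr hloc
  rw [← Fin.val_mk hj, hg]
  exact hp n G (fun i => i.elim ⟨j, hj⟩ v) s₁ ⟨hs₁.1, hs₁.2.1, fun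
    | none => hcount
    | some i => hs₁.2.2 i⟩

end PolyTimeComputable

namespace PolyTimeDecidable

open PolyTimeComputable

variable {ι : Type*} {P Q : ∀ n, SimpleGraph (Fin n) → (ι → Fin n) → Prop}
  {F F' : ∀ n, SimpleGraph (Fin n) → (ι → Fin n) → ℕ}

theorem of_iff (h : PolyTimeDecidable P) (hiff : ∀ n G v, P n G v ↔ Q n G v) :
    PolyTimeDecidable Q := by
  obtain rfl : P = Q := funext fun n => funext fun G => funext fun v => propext (hiff n G v)
  exact h

theorem le (hF : PolyTimeComputable F) (hF' : PolyTimeComputable F') :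
    PolyTimeDecidable fun n G v => F n G v ≤ F' n G v :=
  ((const 1).sub (hF.sub hF')).of_eq fun n G v => by split_ifs <;> omega

theorem adj (i j : ι) : PolyTimeDecidable fun _ G v => G.Adj (v i) (v j) := by
  -- The machine cannot multiply: `v i * n` is computed as a sum of `n` copies of `v i`.
  refine ((sum (F := fun _ _ v _ => v i) (vertex (some i))).add (vertex j)).adjMatrixEntry.of_eq
    fun n G v => ?_
  rw [Finset.sum_const, Finset.card_univ, Fintype.card_fin, smul_eq_mul, mul_comm]
  suffices (∃ x y : Fin n, G.Adj x y ∧ (v i * n + v j : ℕ) = x * n + y) ↔ G.Adj (v i) (v j) by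
    classical exact if_congr ((and_iff_right rfl).trans this) rfl rfl
  refine ⟨?_, fun h => ⟨v i, v j, h, rfl⟩⟩
  rintro ⟨x, y, hxy, hindex⟩
  have hpair : finProdFinEquiv (v i, v j) = finProdFinEquiv (x, y) :=
    Fin.ext (by simpa only [finProdFinEquiv_apply_val, mul_comm n, add_comm] using hindex)
  obtain ⟨hx, hy⟩ := Prod.mk.injEq .. ▸ finProdFinEquiv.injective hpair
  rwa [hx, hy]

theorem not (hP : PolyTimeDecidable P) : PolyTimeDecidable fun n G v => ¬ P n G v :=
  (le hP (const 0)).of_iff fun n G v => by split_ifs <;> simp [*]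

theorem and (hP : PolyTimeDecidable P) (hQ : PolyTimeDecidable Q) :
    PolyTimeDecidable fun n G v => P n G v ∧ Q n G v :=
  (le (const 2) (hP.add hQ)).of_iff fun n G v => by split_ifs <;> simp [*]

theorem eq (i j : ι) :
    PolyTimeDecidable fun n (_ : SimpleGraph (Fin n)) (v : ι → Fin n) => v i = v j :=
  ((le (vertex i) (vertex j)).and (le (vertex j) (vertex i))).of_iff fun _ _ _ => by
    rw [Fin.ext_iff, le_antisymm_iff]

theorem or (hP : PolyTimeDecidable P) (hQ : PolyTimeDecidable Q) :
    PolyTimeDecidable fun n G v => P n G v ∨ Q n G v :=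
  (le (const 1) (hP.add hQ)).of_iff fun n G v => by split_ifs <;> simp [*]

theorem imp (hP : PolyTimeDecidable P) (hQ : PolyTimeDecidable Q) :
    PolyTimeDecidable fun n G v => P n G v → Q n G v :=
  (le hP hQ).of_iff fun n G v => by split_ifs <;> simp [*]

theorem iff (hP : PolyTimeDecidable P) (hQ : PolyTimeDecidable Q) :
    PolyTimeDecidable fun n G v => (P n G v ↔ Q n G v) :=
  ((hP.imp hQ).and (hQ.imp hP)).of_iff fun _ _ _ => iff_iff_implies_and_implies.symm

end PolyTimeDecidable

section Quantifiers

variable {ι : Type*} {P : ∀ n, SimpleGraph (Fin n) → (ι → Fin n) → Fin n → Prop}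

theorem PolyTimeComputable.ncard
    (hP : PolyTimeDecidable fun n G (w : Option ι → Fin n) => P n G (w ∘ some) (w none)) :
    PolyTimeComputable fun n G v => {u | P n G v u}.ncard := by
  classical
  refine (PolyTimeComputable.sum (F := fun n G v u => if P n G v u then 1 else 0)
    (hP.of_eq fun _ _ _ => by congr)).of_eq fun n G v => ?_
  rw [Set.ncard_eq_toFinset_card', Set.toFinset_ofPred, Finset.card_filter]

theorem PolyTimeDecidable.forall
    (hP : PolyTimeDecidable fun n G (w : Option ι → Fin n) => P n G (w ∘ some) (w none)) :
    PolyTimeDecidable fun n G v => ∀ u, P n G v u :=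
  (PolyTimeDecidable.le (.ncard (P := fun n G v u => ¬ P n G v u) hP.not)
    (.const 0)).of_iff fun n G v => by
    rw [nonpos_iff_eq_zero, Set.ncard_eq_zero (Set.toFinite _), Set.eq_empty_iff_forall_notMem]
    exact forall_congr' fun u => not_not

end Quantifiers

theorem polyTimeSolvable_of_polyTimeDecidable {inst yes : ∀ {n : ℕ}, SimpleGraph (Fin n) → Prop}
    {P : ∀ n, SimpleGraph (Fin n) → Prop}
    (hP : PolyTimeDecidable fun n G (_ : Empty → Fin n) => P n G)
    (h : ∀ (n : ℕ) (G : SimpleGraph (Fin n)), inst G → (P n G ↔ yes G)) :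
    PolyTimeSolvable inst yes := by
  obtain ⟨p, b, hp⟩ := hP Empty.elim 1 one_pos Empty.rec
  refine ⟨.seq p (.assign 0 (.var 1)), b + 2, fun n G hG => ?_⟩
  have hinput : Stores (graphInput G) G Empty.elim Empty.elim := ⟨rfl, rfl, Empty.rec⟩
  have hrun : HaltsWithin (.seq p (.assign 0 (.var 1))) (graphInput G) (b.eval n + 2)
      fun s => s.var 0 ≠ 0 ↔ yes G := by
    refine (hp n G _ _ hinput).seq fun s₁ hs₁ => haltsWithin_assign ?_
    rw [State.setVar_var_self, Expr.eval, hs₁.2, ← h n G hG]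
    simp
  obtain ⟨t, s, hexec, ht, hs⟩ := hrun
  exact ⟨t, s, hexec, by simpa using ht, hs⟩

end RAM

namespace TightBColouring

open SimpleGraph

variable {V : Type*}

theorem image_eq_univ_iff_injOn {α β : Type*} [Finite α] [Finite β] {f : α → β} {s : Set α}
    (hs : s.ncard = Nat.card β) : f '' s = Set.univ ↔ Set.InjOn f s := by
  rw [Set.eq_univ_iff_ncard, ← hs, Set.ncard_image_iff]

theorem exists_embedding_forall_eq_iff {α β κ : Type*} [Finite α] [Finite β] {k : α → κ}
    {l : β → κ} : (∃ f : α ↪ β, ∀ a, l (f a) = k a) ↔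
      ∀ a, Nat.card {a' // k a' = k a} ≤ Nat.card {b // l b = k a} := by
  constructor
  · rintro ⟨f, hf⟩ a
    exact Nat.card_le_card_of_injective (Subtype.map f fun a' ha' => (hf a').trans ha')
      (Subtype.map_injective _ f.injective)
  · intro h
    have hfibre (x : κ) : Nonempty ({a // k a = x} ↪ {b // l b = x}) := by
      rcases isEmpty_or_nonempty {a // k a = x} with hempty | ⟨⟨a, rfl⟩⟩
      · exact ⟨.ofIsEmpty⟩
      · cases nonempty_fintype α
        cases nonempty_fintype β
        classical
        exact Function.Embedding.nonempty_of_card_le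
          (by simpa only [Nat.card_eq_fintype_card] using h a)
    let g (x : κ) : {a // k a = x} ↪ {b // l b = x} := (hfibre x).some
    exact ⟨(Equiv.sigmaFiberEquiv k).symm.toEmbedding.trans
      ((Function.Embedding.sigmaMap (.refl κ) g).trans (Equiv.sigmaFiberEquiv l).toEmbedding),
      fun a => (g (k a) ⟨a, rfl⟩).2⟩

/-! ### b-colourings of tight graphs -/

/-- The closed neighbourhood `N[v]`. A b-chromatic vertex is one whose closed neighbourhood meets
all colour classes. -/
def closedNeighborSet (G : SimpleGraph V) (v : V) : Set V :=
  insert v (G.neighborSet v)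

section ClosedNeighborSet

variable {G : SimpleGraph V} {u v : V}

theorem mem_closedNeighborSet : u ∈ closedNeighborSet G v ↔ u = v ∨ G.Adj v u :=
  Iff.rfl

theorem mem_closedNeighborSet_iff_not_compl_adj :
    u ∈ closedNeighborSet G v ↔ ¬ Gᶜ.Adj v u := by
  rw [mem_closedNeighborSet, compl_adj, not_and, not_not, eq_comm, or_iff_not_imp_left, ne_eq]

theorem ncard_closedNeighborSet (G : SimpleGraph V) (v : V) [Fintype (G.neighborSet v)] :
    (closedNeighborSet G v).ncard = G.degree v + 1 := by
  rw [closedNeighborSet, Set.ncard_insert_of_notMem (G.notMem_neighborSet_self),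
    Set.ncard_eq_toFinset_card', Set.toFinset_card, card_neighborSet_eq_degree]

theorem isBChromatic_iff_image_eq_univ {α : Type*} {c : G.Coloring α}
    (hc : Function.Surjective c) :
    IsBChromatic c v ↔ c '' closedNeighborSet G v = Set.univ := by
  rw [Set.eq_univ_iff_forall, hc.forall]
  refine forall_congr' fun w => ⟨fun hw => ?_, ?_⟩
  · by_cases hwv : c w = c v
    · exact ⟨v, .inl rfl, hwv.symm⟩
    · obtain ⟨u, hvu, hu⟩ := hw hwv
      exact ⟨u, .inr hvu, hu⟩
  · rintro ⟨u, rfl | hvu, hu⟩ hwv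
    · exact absurd hu.symm hwv
    · exact ⟨u, hvu, hu⟩

end ClosedNeighborSet

section Finite

variable [Fintype V] {G : SimpleGraph V}

theorem isDense_iff_mDegree_le_ncard {v : V} :
    G.IsDense v ↔ G.mDegree ≤ (closedNeighborSet G v).ncard := by
  classical
  rw [IsDense, ncard_closedNeighborSet]

theorem le_mDegree_iff {k : ℕ} :
    k ≤ G.mDegree ↔ k ≤ {v | k ≤ (closedNeighborSet G v).ncard}.ncard := by
  classical
  have hcard (k : ℕ) : {v | k ≤ (closedNeighborSet G v).ncard}.ncard =
      (Finset.univ.filter fun v => k ≤ G.degree v + 1).card := by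
    rw [Set.ncard_eq_toFinset_card', Set.toFinset_ofPred]
    simp only [ncard_closedNeighborSet]
  refine ⟨fun hk => ?_, fun hk => G.isGreatest_mDegree.2 (hk.trans (hcard k).le)⟩
  calc k ≤ G.mDegree := hk
    _ ≤ {v | G.mDegree ≤ (closedNeighborSet G v).ncard}.ncard :=
      (hcard _).symm ▸ G.isGreatest_mDegree.1
    _ ≤ _ := Set.ncard_le_ncard fun v => hk.trans

theorem isDense_iff_ncard_le_ncard {v : V} :
    G.IsDense v ↔
      {u | (closedNeighborSet G v).ncard + 1 ≤ (closedNeighborSet G u).ncard}.ncard ≤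
        (closedNeighborSet G v).ncard := by
  rw [isDense_iff_mDegree_le_ncard, ← Nat.lt_succ_iff, ← not_le, le_mDegree_iff, not_le,
    Nat.lt_succ_iff]

theorem ncard_setOf_isDense (hG : G.IsTight) : {v | G.IsDense v}.ncard = G.mDegree := by
  classical
  rw [← hG.1, Set.ncard_eq_toFinset_card', Set.toFinset_ofPred]

theorem ncard_closedNeighborSet_of_isDense (hG : G.IsTight) {v : V} (hv : G.IsDense v) :
    (closedNeighborSet G v).ncard = G.mDegree := by
  classical
  rw [← hG.2 v hv, ncard_closedNeighborSet]

theorem ncard_closedNeighborSet_le (hG : G.IsTight) (v : V) :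
    (closedNeighborSet G v).ncard ≤ G.mDegree := by
  by_cases hv : G.IsDense v
  · exact (ncard_closedNeighborSet_of_isDense hG hv).le
  · exact (not_le.1 (mt isDense_iff_mDegree_le_ncard.2 hv)).le

/-- The colouring `c` is injective on the set of dense vertices and on their closed neighbourhoods:
for tight graphs, this is what being a tight b-colouring amounts to. -/
structure IsDenseRainbow (c : G.Coloring (Fin G.mDegree)) : Prop where
  injOn_dense : Set.InjOn c {v | G.IsDense v}
  injOn_closedNeighborSet : ∀ ⦃v⦄, G.IsDense v → Set.InjOn c (closedNeighborSet G v)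

theorem IsDenseRainbow.exists_isDense (hG : G.IsTight) {c : G.Coloring (Fin G.mDegree)}
    (hc : IsDenseRainbow c) (i : Fin G.mDegree) : ∃ v, G.IsDense v ∧ c v = i :=
  ((image_eq_univ_iff_injOn ((ncard_setOf_isDense hG).trans (Nat.card_fin _).symm)).2
    hc.injOn_dense).ge (Set.mem_univ i)

theorem isDense_of_isBChromatic {c : G.Coloring (Fin G.mDegree)} (hc : Function.Surjective c)
    {v : V} (hv : IsBChromatic c v) : G.IsDense v := by
  rw [isDense_iff_mDegree_le_ncard]
  calc G.mDegree = (c '' closedNeighborSet G v).ncard := by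
        rw [(isBChromatic_iff_image_eq_univ hc).1 hv, Set.ncard_univ, Nat.card_fin]
    _ ≤ _ := Set.ncard_image_le

theorem hasTightBColouring_iff_exists_isDenseRainbow (hG : G.IsTight) :
    G.HasTightBColouring ↔ ∃ c : G.Coloring (Fin G.mDegree), IsDenseRainbow c := by
  have himage {c : G.Coloring (Fin G.mDegree)} {s : Set V} (hs : s.ncard = G.mDegree) :
      c '' s = Set.univ ↔ Set.InjOn c s :=
    image_eq_univ_iff_injOn (hs.trans (Nat.card_fin _).symm)
  constructor
  · rintro ⟨c, hsurj, hb⟩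
    have hdense : Set.InjOn c {v | G.IsDense v} := by
      rw [← himage (ncard_setOf_isDense hG), Set.eq_univ_iff_forall, hsurj.forall]
      intro w
      obtain ⟨v, hvw, hv⟩ := hb w
      exact ⟨v, isDense_of_isBChromatic hsurj hv, hvw⟩
    refine ⟨c, hdense, fun v hv => ?_⟩
    obtain ⟨u, huv, hu⟩ := hb v
    obtain rfl : u = v := hdense (isDense_of_isBChromatic hsurj hu) hv huv
    rw [← himage (ncard_closedNeighborSet_of_isDense hG hv)]
    exact (isBChromatic_iff_image_eq_univ hsurj).1 hu
  · rintro ⟨c, hc⟩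
    have hsurj : Function.Surjective c := fun i => (hc.exists_isDense hG i).imp fun _ => And.right
    refine ⟨c, hsurj, fun w => ?_⟩
    obtain ⟨v, hv, hvw⟩ := hc.exists_isDense hG (c w)
    refine ⟨v, hvw, (isBChromatic_iff_image_eq_univ hsurj).2 ?_⟩
    exact (himage (ncard_closedNeighborSet_of_isDense hG hv)).2 (hc.injOn_closedNeighborSet hv)

end Finite

/-! ### Disjoint unions of complete graphs -/

section Cluster

variable {G : SimpleGraph V}

theorem closedNeighborSet_eq_iff_mem (h : Gᶜ.IsCompleteMultipartite) {u v : V} :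
    closedNeighborSet G u = closedNeighborSet G v ↔ u ∈ closedNeighborSet G v := by
  have hmono {u v : V} (huv : u ∈ closedNeighborSet G v) :
      closedNeighborSet G u ⊆ closedNeighborSet G v := fun w hw =>
    mem_closedNeighborSet_iff_not_compl_adj.2 (h.trans _ _ _
      (mem_closedNeighborSet_iff_not_compl_adj.1 huv)
      (mem_closedNeighborSet_iff_not_compl_adj.1 hw))
  refine ⟨fun heq => heq ▸ .inl rfl, fun huv => (hmono huv).antisymm (hmono ?_)⟩
  exact huv.imp .symm .symm

variable [Fintype V]

theorem setOf_isDense_eq_closedNeighborSet (hG : G.IsTight) (h : Gᶜ.IsCompleteMultipartite)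
    {v : V} (hv : G.IsDense v) : {u | G.IsDense u} = closedNeighborSet G v := by
  refine (Set.eq_of_subset_of_ncard_le (fun u hu => ?_) ?_).symm
  · rwa [Set.mem_ofPred, isDense_iff_mDegree_le_ncard, (closedNeighborSet_eq_iff_mem h).2 hu,
      ← isDense_iff_mDegree_le_ncard]
  · rw [ncard_setOf_isDense hG, ncard_closedNeighborSet_of_isDense hG hv]

theorem hasTightBColouring_of_isCompleteMultipartite_compl (hG : G.IsTight)
    (h : Gᶜ.IsCompleteMultipartite) : G.HasTightBColouring := by
  rw [hasTightBColouring_iff_exists_isDenseRainbow hG]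
  obtain ⟨f, hf⟩ : ∃ f : V ↪ Set V × Fin G.mDegree, ∀ v, (f v).1 = closedNeighborSet G v := by
    refine exists_embedding_forall_eq_iff.2 fun v => ?_
    simp only [closedNeighborSet_eq_iff_mem h]
    calc Nat.card (closedNeighborSet G v) ≤ G.mDegree := ncard_closedNeighborSet_le hG v
      _ = Nat.card ({s // s = closedNeighborSet G v} × Fin G.mDegree) := by simp
      _ = _ := Nat.card_congr (Equiv.prodSubtypeFstEquivSubtypeProd).symm
  have hinj (v : V) : Set.InjOn (fun u => (f u).2) (closedNeighborSet G v) := by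
    intro x hx y hy hxy
    refine f.injective (Prod.ext ?_ hxy)
    rw [hf, hf, (closedNeighborSet_eq_iff_mem h).2 hx, (closedNeighborSet_eq_iff_mem h).2 hy]
  refine ⟨.mk (fun v => (f v).2) fun {u v} huv heq =>
    huv.ne (hinj u (.inl rfl) (.inr huv) heq), fun u hu v hv => ?_, fun v _ => hinj v⟩
  rw [setOf_isDense_eq_closedNeighborSet hG h hu] at hv
  exact hinj u (.inl rfl) hv

end Cluster

/-! ### Paw-free graphs -/

/-- `H` has no induced paw (a triangle with a pendant edge): every neighbour `d` of a vertex of a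
triangle is equal or adjacent to another vertex of the triangle. -/
def IsPawFree (H : SimpleGraph V) : Prop :=
  ∀ ⦃a b c d⦄, H.Adj a b → H.Adj a c → H.Adj b c → H.Adj a d → H.Adj d b ∨ H.Adj d c

theorem isPawFree_compl_of_isInducedFree {G : SimpleGraph V}
    (h : G.IsInducedFree (pathGraph 3 ⊕g pathGraph 1)) : IsPawFree Gᶜ := by
  intro a b c d hab hac hbc had
  by_contra! hd
  simp only [compl_adj] at hab hac hbc had hd
  have hdb : G.Adj d b := by grind [G.adj_comm]
  have hdc : G.Adj d c := by grind [G.adj_comm]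
  let f : Fin 3 ⊕ Fin 1 → V := Sum.elim ![b, d, c] ![a]
  have hinj : f.Injective := by
    simp [Function.Injective, f, Sum.forall, Fin.forall_fin_succ, hab, hac, hbc, had, hdb.ne,
      hdc.ne, hdb.ne', hdc.ne', hab.1.symm, hac.1.symm, had.1.symm, hbc.1.symm]
  have hadj : ∀ i j, G.Adj (f i) (f j) ↔ (pathGraph 3 ⊕g pathGraph 1).Adj i j := by
    simp [f, Sum.forall, Fin.forall_fin_succ, pathGraph_adj, hab, hac, hbc, had, hdb, hdc,
      G.adj_comm b, G.adj_comm c, G.adj_comm d a]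
  exact h ⟨⟨⟨f, hinj⟩, hadj _ _⟩⟩

theorem cliqueFree_three_iff {H : SimpleGraph V} :
    H.CliqueFree 3 ↔ ∀ a b c, H.Adj a b → H.Adj a c → ¬ H.Adj b c := by
  classical
  refine ⟨fun h a b c hab hac hbc => h {a, b, c} (is3Clique_triple_iff.2 ⟨hab, hac, hbc⟩),
    fun h t ht => ?_⟩
  obtain ⟨a, b, c, hab, hac, hbc, -⟩ := is3Clique_iff.1 ht
  exact h a b c hab hac hbc

section PawFree

variable {H : SimpleGraph V}

theorem IsPawFree.adj_triangle_of_reachable (hH : IsPawFree H) {a b c d : V} (hab : H.Adj a b)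
    (hac : H.Adj a c) (hbc : H.Adj b c) (hd : H.Reachable a d) :
    H.Adj d a ∨ H.Adj d b ∨ H.Adj d c := by
  rw [reachable_iff_reflTransGen] at hd
  induction hd with
  | refl => exact .inr (.inl hab)
  | @tail d e _ hde ih =>
    have htwo : H.Adj d a ∧ H.Adj d b ∨ H.Adj d a ∧ H.Adj d c ∨ H.Adj d b ∧ H.Adj d c := by
      rcases ih with h | h | h
      · exact (hH hab hac hbc h.symm).imp (⟨h, ·⟩) (.inl ⟨h, ·⟩)
      · exact (hH hab.symm hbc hac h.symm).imp (⟨·, h⟩) (.inr ⟨h, ·⟩)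
      · exact .inr ((hH hac.symm hbc.symm hab h.symm).imp (⟨·, h⟩) (⟨·, h⟩))
    rcases htwo with ⟨ha, hb⟩ | ⟨ha, hc⟩ | ⟨hb, hc⟩
    · exact (hH ha hb hab hde).imp_right .inl
    · exact (hH ha hc hac hde).imp_right .inr
    · exact .inr (hH hb hc hbc hde)

theorem IsPawFree.exists_triangle_of_reachable (hH : IsPawFree H) {a b c d : V} (hab : H.Adj a b)
    (hac : H.Adj a c) (hbc : H.Adj b c) (hd : H.Reachable a d) :
    ∃ x y, H.Adj d x ∧ H.Adj d y ∧ H.Adj x y := by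
  rcases hH.adj_triangle_of_reachable hab hac hbc hd with h | h | h
  · rcases hH hab hac hbc h.symm with h' | h'
    exacts [⟨a, b, h, h', hab⟩, ⟨a, c, h, h', hac⟩]
  · rcases hH hab.symm hbc hac h.symm with h' | h'
    exacts [⟨b, a, h, h', hab.symm⟩, ⟨b, c, h, h', hbc⟩]
  · rcases hH hac.symm hbc.symm hab h.symm with h' | h'
    exacts [⟨c, a, h, h', hac.symm⟩, ⟨c, b, h, h', hbc.symm⟩]

/-- Olariu's theorem on paw-free graphs. -/
theorem IsPawFree.cliqueFree_or_isCompleteMultipartite (hH : IsPawFree H)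
    (hconn : H.Preconnected) : H.CliqueFree 3 ∨ H.IsCompleteMultipartite := by
  by_contra! ⟨htriangle, hmulti⟩
  simp only [cliqueFree_three_iff, not_forall, not_not] at htriangle
  obtain ⟨a, b, c, hab, hac, hbc⟩ := htriangle
  refine hmulti ⟨fun u w v huw hwv huv => ?_⟩
  obtain ⟨x, y, hwx, hwy, hxy⟩ := hH.exists_triangle_of_reachable hab hac hbc (hconn a w)
  have hadj {z : V} (hzw : ¬ H.Adj z w) : H.Adj z x ∧ H.Adj z y := by
    rcases hH.adj_triangle_of_reachable hwx hwy hxy (hconn w z) with h | h | h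
    · exact absurd h hzw
    · exact ⟨h, (hH hwx.symm hxy hwy h.symm).resolve_left hzw⟩
    · exact ⟨(hH hwy.symm hxy.symm hwx h.symm).resolve_left hzw, h⟩
  have hux := (hadj huw).1
  have hvx := (hadj fun hvw => hwv hvw.symm).1
  rcases hH hux.symm hvx.symm huv hwx.symm with h | h
  exacts [huw h.symm, hwv h]

end PawFree

/-! ### Disconnected and triangle-free complements -/

section Fintype

variable [Fintype V] {G : SimpleGraph V}

theorem eq_top_of_not_preconnected_compl (hG : G.IsTight) (h : G.HasTightBColouring)
    (hdisc : ¬ Gᶜ.Preconnected) : G = ⊤ := by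
  obtain ⟨c, hc⟩ := (hasTightBColouring_iff_exists_isDenseRainbow hG).1 h
  have hmem {u d : V} (hu : ¬ Gᶜ.Reachable u d) : u ∈ closedNeighborSet G d :=
    mem_closedNeighborSet_iff_not_compl_adj.2 fun hadj => hu hadj.symm.reachable
  have hinj : Function.Injective c := by
    intro u v huv
    by_contra hne
    have hcompl : Gᶜ.Adj u v := (compl_adj ..).2 ⟨hne, fun hadj => c.valid hadj huv⟩
    obtain ⟨w, hw⟩ : ∃ w, ¬ Gᶜ.Reachable u w := by
      by_contra! hall
      exact hdisc fun x y => (hall x).symm.trans (hall y)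
    obtain ⟨d, hd, hdw⟩ := hc.exists_isDense hG (c w)
    have hud : ¬ Gᶜ.Reachable u d := by
      intro hud
      refine hw (hud.trans ?_)
      by_cases hdw' : d = w
      · rw [hdw']
      · exact ((compl_adj ..).2 ⟨hdw', fun hadj => c.valid hadj hdw⟩ : Gᶜ.Adj d w).reachable
    have hvd : ¬ Gᶜ.Reachable v d := fun hvd => hud (hcompl.reachable.trans hvd)
    exact hne (hc.injOn_closedNeighborSet hd (hmem hud) (hmem hvd) huv)
  have hcard : Nat.card V ≤ G.mDegree := by
    simpa only [Nat.card_fin] using Nat.card_le_card_of_injective c hinj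
  have huniv {s : Set V} (hs : s.ncard = G.mDegree) : s = Set.univ :=
    (Set.eq_univ_iff_ncard s).2 ((Set.ncard_le_card s).antisymm (hs ▸ hcard))
  refine eq_top_iff.2 fun u v huv => ?_
  have hu : G.IsDense u := (huniv (ncard_setOf_isDense hG)).ge (Set.mem_univ u)
  exact ((huniv (ncard_closedNeighborSet_of_isDense hG hu)).ge (Set.mem_univ v)).resolve_left
    huv.symm

/-- The dense vertices adjacent to `v`. -/
def denseNeighborSet (G : SimpleGraph V) (v : V) : Set V :=
  {e | G.IsDense e ∧ G.Adj v e}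

/-- The dense vertices other than `d` that are not adjacent to `d`. -/
def denseNonNeighborSet (G : SimpleGraph V) (d : V) : Set V :=
  {e | G.IsDense e ∧ Gᶜ.Adj d e}

/-- A choice, for each non-dense vertex `v`, of a dense vertex `d` that is to share a colour with
`v` and with no other vertex. It requires that each dense vertex is adjacent to exactly one of `v`
and `d`, apart from `d` itself. -/
def HasDensePartners (G : SimpleGraph V) : Prop :=
  ∃ f : {v // ¬ G.IsDense v} ↪ {v // G.IsDense v},
    ∀ v, denseNonNeighborSet G (f v) = denseNeighborSet G v

theorem hasDensePartners_of_hasTightBColouring (hG : G.IsTight) (htri : Gᶜ.CliqueFree 3)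
    (h : G.HasTightBColouring) : HasDensePartners G := by
  rw [cliqueFree_three_iff] at htri
  obtain ⟨c, hc⟩ := (hasTightBColouring_iff_exists_isDenseRainbow hG).1 h
  choose d hd hdc using fun v => hc.exists_isDense hG (c v)
  have hcompl {u v : V} (hne : u ≠ v) (huv : c u = c v) : Gᶜ.Adj u v :=
    (compl_adj ..).2 ⟨hne, fun hadj => c.valid hadj huv⟩
  have hne {v : V} (hv : ¬ G.IsDense v) : v ≠ d v := fun heq => hv (heq ▸ hd v)
  refine ⟨⟨fun v => ⟨d v, hd v⟩, fun u v huv => ?_⟩, fun ⟨v, hv⟩ => ?_⟩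
  · by_contra huv'
    have heq : d u = d v := congrArg Subtype.val huv
    exact htri u v (d u) (hcompl (Subtype.coe_ne_coe.2 huv') (by rw [← hdc u, ← hdc v, heq]))
      (hcompl (hne u.2) (hdc u).symm) (heq ▸ hcompl (hne v.2) (hdc v).symm)
  · have hvd : Gᶜ.Adj v (d v) := hcompl (hne hv) (hdc v).symm
    ext e
    refine and_congr_right fun he => ⟨fun hde => ?_, fun hve => (compl_adj ..).2 ⟨?_, ?_⟩⟩
    · by_contra hve
      exact htri v (d v) e hvd ((compl_adj ..).2 ⟨fun heq => hv (heq ▸ he), hve⟩) hde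
    · rintro rfl
      exact hvd.2 hve
    · exact fun hde => hne hv (hc.injOn_closedNeighborSet he (.inr hve.symm) (.inr hde.symm)
        (hdc v).symm)

theorem hasTightBColouring_of_hasDensePartners (hG : G.IsTight) (h : HasDensePartners G) :
    G.HasTightBColouring := by
  classical
  obtain ⟨f, hf⟩ := h
  let g (v : V) : {v // G.IsDense v} := if hv : G.IsDense v then ⟨v, hv⟩ else f ⟨v, hv⟩
  have hg_dense {v : V} (hv : G.IsDense v) : g v = ⟨v, hv⟩ := dif_pos hv
  have hg_not {v : V} (hv : ¬ G.IsDense v) : g v = f ⟨v, hv⟩ := dif_neg hv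
  have hinj : Set.InjOn g {v | G.IsDense v} := fun x hx y hy hxy => by
    rwa [hg_dense hx, hg_dense hy, Subtype.mk.injEq] at hxy
  have hinj_not : Set.InjOn g {v | ¬ G.IsDense v} := fun x hx y hy hxy => by
    rwa [hg_not hx, hg_not hy, f.injective.eq_iff, Subtype.mk.injEq] at hxy
  have hmixed {d x y : V} (hd : G.IsDense d) (hx : G.IsDense x) (hy : ¬ G.IsDense y)
      (hdx : x ∈ closedNeighborSet G d) (hdy : y ∈ closedNeighborSet G d) : g x ≠ g y := by
    intro hxy
    rw [hg_dense hx, hg_not hy] at hxy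
    have hyd : d ∈ denseNeighborSet G y :=
      ⟨hd, (hdy.resolve_left fun heq => hy (heq ▸ hd)).symm⟩
    rw [← hf ⟨y, hy⟩, ← hxy] at hyd
    exact mem_closedNeighborSet_iff_not_compl_adj.1 hdx hyd.2.symm
  have hinj_nbhd {d : V} (hd : G.IsDense d) : Set.InjOn g (closedNeighborSet G d) := by
    intro x hx y hy hxy
    by_cases hxd : G.IsDense x <;> by_cases hyd : G.IsDense y
    · exact hinj hxd hyd hxy
    · exact absurd hxy (hmixed hd hxd hyd hx hy)
    · exact absurd hxy.symm (hmixed hd hyd hxd hy hx)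
    · exact hinj_not hxd hyd hxy
  have hproper {u v : V} (huv : G.Adj u v) : g u ≠ g v := by
    intro heq
    by_cases hu : G.IsDense u
    · exact huv.ne (hinj_nbhd hu (.inl rfl) (.inr huv) heq)
    by_cases hv : G.IsDense v
    · exact huv.ne (hinj_nbhd hv (.inr huv.symm) (.inl rfl) heq)
    · exact huv.ne (hinj_not hu hv heq)
  let e : {v // G.IsDense v} ≃ Fin G.mDegree := Finite.equivFinOfCardEq (ncard_setOf_isDense hG)
  exact (hasTightBColouring_iff_exists_isDenseRainbow hG).2
    ⟨.mk (e ∘ g) fun huv heq => hproper huv (e.injective heq),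
      e.injective.comp_injOn hinj, fun v hv => e.injective.comp_injOn (hinj_nbhd hv)⟩

theorem hasDensePartners_iff_forall_ncard_le :
    HasDensePartners G ↔ ∀ v, ¬ G.IsDense v →
      {u | ¬ G.IsDense u ∧ denseNeighborSet G u = denseNeighborSet G v}.ncard ≤
        {d | G.IsDense d ∧ denseNonNeighborSet G d = denseNeighborSet G v}.ncard := by
  refine (exists_embedding_forall_eq_iff
    (k := fun v : {v // ¬ G.IsDense v} => denseNeighborSet G v)
    (l := fun d : {v // G.IsDense v} => denseNonNeighborSet G d)).trans ?_
  refine Subtype.forall.trans (forall₂_congr fun v _ => ?_)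
  refine iff_of_eq (congrArg₂ (· ≤ ·) (Nat.card_congr ?_) (Nat.card_congr ?_))
  · exact Equiv.subtypeSubtypeEquivSubtypeInter (fun u => ¬ G.IsDense u)
      fun u => denseNeighborSet G u = denseNeighborSet G v
  · exact Equiv.subtypeSubtypeEquivSubtypeInter G.IsDense
      fun d => denseNonNeighborSet G d = denseNeighborSet G v

theorem hasTightBColouring_iff_of_isInducedFree (hG : G.IsTight)
    (hfree : G.IsInducedFree (pathGraph 3 ⊕g pathGraph 1)) :
    G.HasTightBColouring ↔
      Gᶜ.IsCompleteMultipartite ∨ Gᶜ.CliqueFree 3 ∧ HasDensePartners G := by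
  constructor
  · intro h
    by_cases hconn : Gᶜ.Preconnected
    · refine ((isPawFree_compl_of_isInducedFree hfree).cliqueFree_or_isCompleteMultipartite
        hconn).elim (fun htri => .inr ⟨htri, ?_⟩) .inl
      exact hasDensePartners_of_hasTightBColouring hG htri h
    · rw [eq_top_of_not_preconnected_compl hG h hconn, compl_top]
      exact .inl bot_isCompleteMultipartite
  · rintro (hmulti | ⟨-, hpartners⟩)
    · exact hasTightBColouring_of_isCompleteMultipartite_compl hG hmulti
    · exact hasTightBColouring_of_hasDensePartners hG hpartners

end Fintype

/-! ### Polynomial-time decidability -/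

section Decidability

open RAM RAM.PolyTimeDecidable

variable {ι : Type*}

theorem polyTimeDecidable_compl_adj (i j : ι) :
    PolyTimeDecidable fun _ G v => Gᶜ.Adj (v i) (v j) :=
  ((eq i j).not.and (adj i j).not).of_iff fun _ _ _ => (compl_adj ..).symm

theorem polyTimeDecidable_isCompleteMultipartite_compl :
    PolyTimeDecidable fun _ G (_ : ι → _) => Gᶜ.IsCompleteMultipartite := by
  refine PolyTimeDecidable.of_iff (P := fun n G (_ : ι → Fin n) => ∀ a b c : Fin n,
    ¬ Gᶜ.Adj a b → ¬ Gᶜ.Adj b c → ¬ Gᶜ.Adj a c) ?_ fun _ _ _ => ⟨.mk, fun h => h.trans⟩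
  refine .forall (.forall (.forall ?_))
  exact (polyTimeDecidable_compl_adj (some (some none)) (some none)).not.imp
    ((polyTimeDecidable_compl_adj (some none) none).not.imp
      (polyTimeDecidable_compl_adj (some (some none)) none).not)

theorem polyTimeDecidable_cliqueFree_compl :
    PolyTimeDecidable fun _ G (_ : ι → _) => Gᶜ.CliqueFree 3 := by
  refine PolyTimeDecidable.of_iff (.forall (.forall (.forall ?_))) fun _ _ _ =>
    cliqueFree_three_iff.symm
  exact (polyTimeDecidable_compl_adj (some (some none)) (some none)).imp
    ((polyTimeDecidable_compl_adj (some (some none)) none).imp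
      (polyTimeDecidable_compl_adj (some none) none).not)

theorem polyTimeComputable_ncard_closedNeighborSet (i : ι) :
    PolyTimeComputable fun _ G v => (closedNeighborSet G (v i)).ncard :=
  .ncard (P := fun _ G v u => u ∈ closedNeighborSet G (v i))
    ((eq none (some i)).or (adj (some i) none))

theorem polyTimeDecidable_isDense (i : ι) : PolyTimeDecidable fun _ G v => G.IsDense (v i) := by
  refine (le (.ncard (le (.add ?_ (.const 1)) ?_)) ?_).of_iff fun _ _ _ =>
    isDense_iff_ncard_le_ncard.symm
  · exact polyTimeComputable_ncard_closedNeighborSet (some i)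
  · exact polyTimeComputable_ncard_closedNeighborSet none
  · exact polyTimeComputable_ncard_closedNeighborSet i

theorem polyTimeDecidable_mem_denseNeighborSet (i j : ι) :
    PolyTimeDecidable fun _ G v => v j ∈ denseNeighborSet G (v i) :=
  (polyTimeDecidable_isDense j).and (adj i j)

theorem polyTimeDecidable_mem_denseNonNeighborSet (i j : ι) :
    PolyTimeDecidable fun _ G v => v j ∈ denseNonNeighborSet G (v i) :=
  (polyTimeDecidable_isDense j).and (polyTimeDecidable_compl_adj i j)

theorem polyTimeDecidable_hasDensePartners :
    PolyTimeDecidable fun _ G (_ : ι → _) => HasDensePartners G := by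
  refine PolyTimeDecidable.of_iff (.forall (.imp (polyTimeDecidable_isDense none).not
    (le (.ncard ?_) (.ncard ?_)))) fun _ _ _ => hasDensePartners_iff_forall_ncard_le.symm
  · refine (polyTimeDecidable_isDense none).not.and
      (.of_iff (.forall ?_) fun _ _ _ => Set.ext_iff.symm)
    exact (polyTimeDecidable_mem_denseNeighborSet (some none) none).iff
      (polyTimeDecidable_mem_denseNeighborSet (some (some none)) none)
  · refine (polyTimeDecidable_isDense none).and
      (.of_iff (.forall ?_) fun _ _ _ => Set.ext_iff.symm)
    exact (polyTimeDecidable_mem_denseNonNeighborSet (some none) none).iff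
      (polyTimeDecidable_mem_denseNeighborSet (some (some none)) none)

end Decidability

end TightBColouring

/-- Tight b-Chromatic Number is polynomial-time solvable for `(P₃ + P₁)`-free graphs. -/
theorem mainTheorem6 :
    RAM.PolyTimeSolvable
      (fun G => G.IsTight ∧
        G.IsInducedFree (SimpleGraph.pathGraph 3 ⊕g SimpleGraph.pathGraph 1))
      (fun G => G.HasTightBColouring) := by
  open TightBColouring in
  exact RAM.polyTimeSolvable_of_polyTimeDecidable
    (P := fun _ G => Gᶜ.IsCompleteMultipartite ∨ Gᶜ.CliqueFree 3 ∧ HasDensePartners G)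
    (polyTimeDecidable_isCompleteMultipartite_compl.or
      (polyTimeDecidable_cliqueFree_compl.and polyTimeDecidable_hasDensePartners))
    fun _ _ ⟨hG, hfree⟩ => (hasTightBColouring_iff_of_isInducedFree hG hfree).symm
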